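/- \textbf{Graph-like spaces.} A \emph{graph-like space} $G$ is a Hausdorff topological space together with a vertex set $V(G)$, an edge set $E(G)$ and, for each $e\in E(G)$, a continuous map $\iota_e:[0,1]\to G$ such that: the underlying set of $G$ is the disjoint union of $V(G)$ and $(0,1)\times E(G)$; $\iota_e(t)=(t,e)$ for $t\in(0,1)$ (these are the \emph{inner points} of $e$); $\iota_e(0),\iota_e(1)\in V(G)$ (the \emph{end-vertices} of $e$); $\iota_e|_{(0,1)}$ is an open map; and for any distinct $v,v'\in V(G)$ there are disjoint open sets $U\ni v$, $U'\ni v'$ with $V(G)\subseteq U\cup U'$. A \emph{sub-graph-like space} is a subspace consisting of some vertices and of all inner points of some edges, and containing the end-vertices of these edges. A \emph{pseudo-arc} in $G$ from $a$ to $b$ ($a,b\in V(G)$) is a compact connected sub-graph-like space $P$ containing $a$ and $b$ such that, for every edge $e$ of $P$, the vertices $a$ and $b$ lie in different components of $P-e$ (that is, $P$ without the inner points of $e$). \textbf{Tree-like spaces.} A \emph{tree-like space} is a compact graph-like space $T$ without loops (edges with $\iota_e(0)=\iota_e(1)$) in which for any two vertices $a,b$ there is a unique pseudo-arc $P(a,b)$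 from $a$ to $b$. Its \emph{edge tree set} $\tau(T)$ is the set of all pairs $(\iota_e(0),\iota_e(1))$ and $(\iota_e(1),\iota_e(0))$, $e\in E(T)$, with the involution $(x,y)^*=(y,x)$ and the order in which $(x,y)<(v,w)$ if and only if $\{x,y\}\ne\{v,w\}$ and $P(y,v)\subseteq P(x,v)\subseteq P(x,w)$. \textbf{Minors.} For $F\subseteq E(G)$ let $\sim_F$ be the smallest equivalence relation on $G$ that identifies all points of $\iota_e([0,1])$ for each $e\in F$ and has a Hausdorff quotient. The \emph{contraction} $G/F$ is the quotient space $G/{\sim_F}$ with vertex set $\{[v] : v\in V(G)\}$ and edge set $E(G)\setminus F$. Deleting edges means deleting their inner points. A graph-like space $G'$ is a \emph{minor} of $G$ if there are disjoint $F_1,F_2\subseteq E(G)$ and a set $W$ of vertices of $(G/F_1)-F_2$, none of which is an end-vertex of an edge of $(G/F_1)-F_2$, such that there is a homeomorphism from $G'$ to $((G/F_1)-F_2)-W$ that induces a bijection between the vertex sets. \textbf{Theorem.} Let $T_1$ and $T_2$ be tree-like spaces such that $T_1$ is a minor of $T_2$. Then $\tau(T_1)$ is isomorphic to a subset of $\tau(T_2)$: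 there are a subset $S\subseteq\tau(T_2)$ closed under the involution and a bijection $\varphi:\tau(T_1)\to S$ such that $\varphi(p^*)=\varphi(p)^*$ for all $p\in\tau(T_1)$, and $p\le q$ if and only if $\varphi(p)\le\varphi(q)$ for all $p,q\in\tau(T_1)$. -/

import Mathlib

open Set Topology

universe u v

/-- A graph-like space with underlying space `X` and edge set `E`. The underlying set is the
disjoint union of the vertex set `verts` and of `(0,1) × E`, where the inner point `(t, e)` is
written `emb e t`. Graph-like spaces are Hausdorff. -/
structure GraphLikeSpace (X : Type u) (E : Type v) [TopologicalSpace X] where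
  /-- the vertex set -/
  verts : Set X
  /-- the map `ι_e : [0,1] → X` of an edge `e` -/
  emb : E → unitInterval → X
  t2 : T2Space X
  continuous_emb : ∀ e, Continuous (emb e)
  /-- every point is a vertex or an inner point of an edge ... -/
  cover : ∀ x, x ∈ verts ∨ ∃ e, ∃ t ∈ Ioo (0 : unitInterval) 1, emb e t = x
  /-- ... but not both, ... -/
  inner_notMem : ∀ e, ∀ t ∈ Ioo (0 : unitInterval) 1, emb e t ∉ verts
  /-- ... and an inner point determines its edge and its parameter. -/
  inner_inj : ∀ e e', ∀ t ∈ Ioo (0 : unitInterval) 1, ∀ t' ∈ Ioo (0 : unitInterval) 1,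
    emb e t = emb e' t' → e = e' ∧ t = t'
  emb_zero_mem : ∀ e, emb e 0 ∈ verts
  emb_one_mem : ∀ e, emb e 1 ∈ verts
  isOpenMap_emb : ∀ e, IsOpenMap ((Ioo (0 : unitInterval) 1).domRestrict (emb e))
  /-- any two distinct vertices are separated by disjoint open sets which partition the
  vertex set -/
  separated : ∀ a ∈ verts, ∀ b ∈ verts, a ≠ b → ∃ U U' : Set X, IsOpen U ∧ IsOpen U' ∧
    Disjoint U U' ∧ verts ⊆ U ∪ U' ∧ a ∈ U ∧ b ∈ U'

namespace GraphLikeSpace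

variable {X : Type u} {E : Type v} [TopologicalSpace X]

/-- The set of inner points of the edge `e`. -/
def inner (G : GraphLikeSpace X E) (e : E) : Set X :=
  G.emb e '' Ioo (0 : unitInterval) 1

/-- `Y` is the point set of a sub-graph-like space of `G` (with vertex set `verts ∩ Y`, with the
edges whose image lies in `Y`, and with the subspace topology): if `Y` contains an inner point of
an edge, then it contains that edge with its end-vertices. -/
def IsSub (G : GraphLikeSpace X E) (Y : Set X) : Prop :=
  ∀ e, (G.inner e ∩ Y).Nonempty → range (G.emb e) ⊆ Y

/-- `Y` is (the point set of) a pseudo-arc in `G` with start-vertex `a` and end-vertex `b`: a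
compact connected sub-graph-like space such that for each of its edges `e` the vertices `a` and
`b` lie in different components of `Y - e`. -/
structure IsPseudoArc (G : GraphLikeSpace X E) (Y : Set X) (a b : X) : Prop where
  isSub : G.IsSub Y
  isCompact : IsCompact Y
  isConnected : IsConnected Y
  start_vert : a ∈ G.verts
  end_vert : b ∈ G.verts
  start_mem : a ∈ Y
  end_mem : b ∈ Y
  separates : ∀ e, range (G.emb e) ⊆ Y → b ∉ connectedComponentIn (Y \ G.inner e) a

/-- A tree-like space is a compact loop-free graph-like space in which any two vertices are joined
by a unique pseudo-arc. -/
structure IsTreeLike (G : GraphLikeSpace X E) : Prop where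
  compact : CompactSpace X
  loopFree : ∀ e, G.emb e 0 ≠ G.emb e 1
  existsUnique_arc : ∀ a ∈ G.verts, ∀ b ∈ G.verts, ∃! Y : Set X, G.IsPseudoArc Y a b

open Classical in
/-- `P(a,b)`, the pseudo-arc from `a` to `b` (unique if `G` is tree-like and `a`, `b` are
vertices). -/
noncomputable def arc (G : GraphLikeSpace X E) (a b : X) : Set X :=
  if h : ∃ Y : Set X, G.IsPseudoArc Y a b then h.choose else ∅

/-- The oriented edges of `G`: the pairs `(ι_e(0), ι_e(1))` and `(ι_e(1), ι_e(0))`. This is the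
ground set of the edge tree set `τ(G)`. -/
@[ext]
structure OrientedEdge (G : GraphLikeSpace X E) where
  tail : X
  head : X
  isEdge : ∃ e, (tail = G.emb e 0 ∧ head = G.emb e 1) ∨ (tail = G.emb e 1 ∧ head = G.emb e 0)

/-- The involution `(x,y)* = (y,x)` of the edge tree set. -/
def OrientedEdge.inv {G : GraphLikeSpace X E} (p : G.OrientedEdge) : G.OrientedEdge where
  tail := p.head
  head := p.tail
  isEdge := by
    obtain ⟨e, h | h⟩ := p.isEdge
    · exact ⟨e, Or.inr ⟨h.2, h.1⟩⟩
    · exact ⟨e, Or.inl ⟨h.2, h.1⟩⟩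

/-- The order of the edge tree set: `(x,y) < (v,w)` if and only if `{x,y} ≠ {v,w}` and
`P(y,v) ⊆ P(x,v) ⊆ P(x,w)`. -/
instance (G : GraphLikeSpace X E) : LE G.OrientedEdge where
  le p q := p = q ∨
    (({p.tail, p.head} : Set X) ≠ {q.tail, q.head} ∧
      G.arc p.head q.tail ⊆ G.arc p.tail q.tail ∧
      G.arc p.tail q.tail ⊆ G.arc p.tail q.head)

/-- The equivalence relations on `G` with Hausdorff quotient which identify all points of each
edge in `F` (end-vertices included). -/
def contractionSetoids (G : GraphLikeSpace X E) (F : Set E) : Set (Setoid X) :=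
  {r | T2Space (Quotient r) ∧ ∀ e ∈ F, ∀ s t, r (G.emb e s) (G.emb e t)}

/-- The relation `∼_F`: the smallest member of `contractionSetoids`. -/
def contractionSetoid (G : GraphLikeSpace X E) (F : Set E) : Setoid X :=
  sInf (G.contractionSetoids F)

/-- The smallest relation exists, and `contractionSetoid` is that relation. -/
theorem contractionSetoid_isLeast (G : GraphLikeSpace X E) (F : Set E) :
    IsLeast (G.contractionSetoids F) (G.contractionSetoid F) := by
  refine ⟨⟨?_, fun e he s t r hr => hr.2 e he s t⟩, fun r hr => sInf_le hr⟩
  refine ⟨fun x y => ?_⟩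
  induction x using Quotient.inductionOn with | _ x
  induction y using Quotient.inductionOn with | _ y
  intro hxy
  have hn : ¬ (G.contractionSetoid F) x y := fun h => hxy (Quotient.sound h)
  obtain ⟨r, hr, hrxy⟩ : ∃ r ∈ G.contractionSetoids F, ¬ r x y := by
    by_contra! hcon
    exact hn fun r hr => hcon r hr
  have hle : ∀ a b, (G.contractionSetoid F) a b → r a b := fun a b h => h r hr
  let f : Quotient (G.contractionSetoid F) → Quotient r :=
    Quotient.map' id hle
  have hf : Continuous f := Continuous.quotient_map' continuous_id hle
  have := hr.1
  have hne : f (Quotient.mk _ x) ≠ f (Quotient.mk _ y) := fun h => hrxy (Quotient.exact h)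
  obtain ⟨U, U', hU, hU', hx, hy, hd⟩ := t2_separation hne
  exact ⟨f ⁻¹' U, f ⁻¹' U', hU.preimage hf, hU'.preimage hf, hx, hy, hd.preimage f⟩

/-- The underlying (quotient) space of the contraction `G/F`. -/
abbrev Contraction (G : GraphLikeSpace X E) (F : Set E) : Type u :=
  Quotient (G.contractionSetoid F)

/-- The class in `G/F` of a point of `G`. For `e ∉ F` the edge map of `e` in `G/F` is
`t ↦ G.toContraction F (G.emb e t)`. -/
def toContraction (G : GraphLikeSpace X E) (F : Set E) (x : X) : G.Contraction F :=
  Quotient.mk (G.contractionSetoid F) x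

/-- The vertex set of the contraction `G/F`. -/
def contractionVerts (G : GraphLikeSpace X E) (F : Set E) : Set (G.Contraction F) :=
  G.toContraction F '' G.verts

/-- The point set of `((G/F₁) - F₂) - W`: delete from `G/F₁` the inner points of the edges in `F₂`
and the points of `W`. -/
def minorPoints (G : GraphLikeSpace X E) (F₁ F₂ : Set E) (W : Set (G.Contraction F₁)) :
    Set (G.Contraction F₁) :=
  {z | (∀ e ∈ F₂, z ∉ G.toContraction F₁ '' G.inner e) ∧ z ∉ W}

/-- `G'` is a minor of `G`: there are disjoint sets `F₁`, `F₂` of edges of `G` and a set `W` of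
vertices of `(G/F₁) - F₂` which are not end-vertices of edges of `(G/F₁) - F₂`, such that `G'` is
isomorphic to `((G/F₁) - F₂) - W`, by a homeomorphism that maps vertices to vertices and
non-vertices to non-vertices. -/
def IsMinor {X' : Type*} {E' : Type*} [TopologicalSpace X'] (G' : GraphLikeSpace X' E')
    (G : GraphLikeSpace X E) : Prop :=
  ∃ F₁ F₂ : Set E, Disjoint F₁ F₂ ∧ ∃ W : Set (G.Contraction F₁),
    W ⊆ G.contractionVerts F₁ ∧
    (∀ e, e ∉ F₁ → e ∉ F₂ →
      G.toContraction F₁ (G.emb e 0) ∉ W ∧ G.toContraction F₁ (G.emb e 1) ∉ W) ∧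
    ∃ φ : X' ≃ₜ G.minorPoints F₁ F₂ W,
      ∀ x, x ∈ G'.verts ↔ (φ x : G.Contraction F₁) ∈ G.contractionVerts F₁

end GraphLikeSpace

/-! In a tree-like space every edge `e` is a bridge: if its ends lay in one component of the
complement of its inner points, that component would contain a second pseudo-arc between them
(`exists_isPseudoArc_subset`). By compactness the complement splits into two clopen sides. This
yields a cut function, continuous into [0,1], which is the parameter on `e` and 0 or 1 elsewhere
(`IsTreeLike.exists_isCut`). The arc between two vertices runs through `e` exactly when the cut
function differs at them, so the order of the edge tree set only records which vertices lie on which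
side of which edge (`OrientedEdge.le_iff`).

Cut functions survive in minors. For an uncontracted edge the kernel of its cut function is an
admissible relation, so the cut function factors through the contraction. Hence the uncontracted
edges remain disjoint open sets there, each edge of `T₁` is mapped onto one of them
(`exists_image_inner_eq`), its ends go to the classes of the ends, and sides go to sides
(`Corresponds.cut_eq_head_iff`). The order is therefore preserved and reflected. -/

/-! ### General topology -/

theorem isPreconnected_sInter_of_isChain {X : Type*} [TopologicalSpace X] [T2Space X]
    {c : Set (Set X)} (hc : IsChain (· ⊆ ·) c) (hne : c.Nonempty)
    (hcomp : ∀ s ∈ c, IsCompact s) (hconn : ∀ s ∈ c, IsPreconnected s) :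
    IsPreconnected (⋂₀ c) := by
  have hclosed : IsClosed (⋂₀ c) := isClosed_sInter fun s hs => (hcomp s hs).isClosed
  obtain ⟨s₀, hs₀⟩ := hne
  have hK : IsCompact (⋂₀ c) := (hcomp s₀ hs₀).of_isClosed_subset hclosed (sInter_subset_of_mem hs₀)
  rw [isPreconnected_iff_subset_of_fully_disjoint_closed hclosed]
  intro u v hu hv huv hd
  obtain ⟨U, V, hU, hV, huU, hvV, hUV⟩ := SeparatedNhds.of_isCompact_isCompact
    (hK.inter_right hu) (hK.inter_right hv) (hd.mono inter_subset_right inter_subset_right)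
  have : Nonempty c := ⟨⟨s₀, hs₀⟩⟩
  have hdir : Directed (· ⊇ ·) (fun s : c => (s : Set X)) := by
    intro s t
    rcases hc.total s.2 t.2 with h | h
    · exact ⟨s, subset_rfl, h⟩
    · exact ⟨t, h, subset_rfl⟩
  have hsub : ⋂₀ c ⊆ U ∪ V := fun x hx => (huv hx).imp (fun h => huU ⟨hx, h⟩) fun h => hvV ⟨hx, h⟩
  -- By compactness a single member of the chain already lies in `U ∪ V`; being connected, it lies
  -- on one side.
  obtain ⟨⟨s, hs⟩, hsUV⟩ := exists_subset_nhds_of_isCompact' hdir (fun s => hcomp s s.2)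
    (fun s => (hcomp s s.2).isClosed) (U := U ∪ V)
    (fun x hx => (hU.union hV).mem_nhds (hsub (by rwa [sInter_eq_iInter])))
  rcases (hconn s hs).subset_or_subset hU hV hUV hsUV with h | h
  · refine Or.inl fun x hx => (huv hx).resolve_right fun hxv => ?_
    exact hUV.le_bot ⟨h (sInter_subset_of_mem hs hx), hvV ⟨hx, hxv⟩⟩
  · refine Or.inr fun x hx => (huv hx).resolve_left fun hxu => ?_
    exact hUV.le_bot ⟨huU ⟨hx, hxu⟩, h (sInter_subset_of_mem hs hx)⟩

/-- Used to confine a connected set of inner points to a single edge. -/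
theorem IsPreconnected.subset_of_pairwise_disjoint_isOpen {X ι : Type*} [TopologicalSpace X]
    {s : Set X} (hs : IsPreconnected s) {U : ι → Set X} (hU : ∀ i, IsOpen (U i))
    (hd : Pairwise fun i j => Disjoint (U i) (U j)) (hsU : s ⊆ ⋃ i, U i) {i : ι}
    (hi : (s ∩ U i).Nonempty) : s ⊆ U i := by
  refine hs.subset_left_of_subset_union (hU i) (isOpen_biUnion (s := {j | j ≠ i}) fun j _ => hU j)
    ?_ ?_ hi
  · exact disjoint_iUnion₂_right.2 fun j hj => hd (Ne.symm hj)
  · intro x hx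
    obtain ⟨j, hj⟩ := mem_iUnion.1 (hsU hx)
    by_cases h : j = i
    · exact Or.inl (h ▸ hj)
    · exact Or.inr (mem_iUnion₂.2 ⟨j, h, hj⟩)

theorem IsPreconnected.apply_eq_of_zero_or_one {X : Type*} [TopologicalSpace X] {s : Set X}
    (hs : IsPreconnected s) {f : X → unitInterval} (hf : Continuous f)
    (h : ∀ x ∈ s, f x = 0 ∨ f x = 1) {x y : X} (hx : x ∈ s) (hy : y ∈ s) : f x = f y := by
  have hfin : ({0, 1} : Set unitInterval).Finite := by simp
  exact hfin.countable.isTotallyDisconnected (f '' s)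
    (by rintro _ ⟨z, hz, rfl⟩; simpa using h z hz) (hs.image f hf.continuousOn)
    (mem_image_of_mem f hx) (mem_image_of_mem f hy)

theorem unitInterval.eq_zero_or_one_of_notMem_Ioo {t : unitInterval} (h : t ∉ Ioo (0 : unitInterval) 1) :
    t = 0 ∨ t = 1 := by
  by_contra! hc
  exact h ⟨unitInterval.pos_iff_ne_zero.2 hc.1, unitInterval.lt_one_iff_ne_one.2 hc.2⟩

theorem unitInterval.exists_mem_Ioo : ∃ t : unitInterval, t ∈ Ioo (0 : unitInterval) 1 :=
  nonempty_Ioo.2 zero_lt_one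

/-! ### Edges, sub-graph-like spaces and existence of pseudo-arcs -/

namespace GraphLikeSpace

variable {X : Type u} {E : Type v} [TopologicalSpace X] {G : GraphLikeSpace X E}

theorem isOpen_inner (G : GraphLikeSpace X E) (e : E) : IsOpen (G.inner e) := by
  have := (G.isOpenMap_emb e).isOpen_range
  rwa [range_domRestrict] at this

theorem isPreconnected_inner (G : GraphLikeSpace X E) (e : E) : IsPreconnected (G.inner e) :=
  isPreconnected_Ioo.image _ (G.continuous_emb e).continuousOn

theorem inner_nonempty (G : GraphLikeSpace X E) (e : E) : (G.inner e).Nonempty :=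
  unitInterval.exists_mem_Ioo.imp' (G.emb e) fun _ ht => mem_image_of_mem _ ht

theorem inner_subset_range (G : GraphLikeSpace X E) (e : E) : G.inner e ⊆ range (G.emb e) :=
  image_subset_range _ _

theorem notMem_verts_of_mem_inner {e : E} {x : X} (hx : x ∈ G.inner e) : x ∉ G.verts := by
  obtain ⟨t, ht, rfl⟩ := hx
  exact G.inner_notMem e t ht

theorem eq_of_mem_inner {e e' : E} {x : X} (hx : x ∈ G.inner e) (hx' : x ∈ G.inner e') :
    e = e' := by
  obtain ⟨t, ht, rfl⟩ := hx
  obtain ⟨t', ht', h⟩ := hx'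
  exact (G.inner_inj e e' t ht t' ht' h.symm).1

theorem pairwise_disjoint_inner (G : GraphLikeSpace X E) :
    Pairwise fun e e' => Disjoint (G.inner e) (G.inner e') := fun _ _ hne =>
  disjoint_left.2 fun _ hx hx' => hne (eq_of_mem_inner hx hx')

theorem exists_mem_inner {x : X} (hx : x ∉ G.verts) : ∃ e, x ∈ G.inner e :=
  (G.cover x).resolve_left hx

theorem range_emb_subset (G : GraphLikeSpace X E) (e : E) :
    range (G.emb e) ⊆ G.inner e ∪ {G.emb e 0, G.emb e 1} := by
  rintro _ ⟨t, rfl⟩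
  by_cases ht : t ∈ Ioo (0 : unitInterval) 1
  · exact Or.inl (mem_image_of_mem _ ht)
  · rcases unitInterval.eq_zero_or_one_of_notMem_Ioo ht with rfl | rfl <;> simp

theorem range_emb_subset_inner_union_verts (G : GraphLikeSpace X E) (e : E) :
    range (G.emb e) ⊆ G.inner e ∪ G.verts := by
  refine (G.range_emb_subset e).trans (union_subset_union_right _ ?_)
  rintro x (rfl | rfl)
  exacts [G.emb_zero_mem e, G.emb_one_mem e]

theorem eq_of_mem_inner_of_mem_range {e e' : E} {x : X} (hx : x ∈ G.inner e)
    (hx' : x ∈ range (G.emb e')) : e = e' := by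
  rcases G.range_emb_subset_inner_union_verts e' hx' with h | h
  · exact eq_of_mem_inner hx h
  · exact absurd h (notMem_verts_of_mem_inner hx)

theorem isCompact_range_emb (G : GraphLikeSpace X E) (e : E) : IsCompact (range (G.emb e)) :=
  isCompact_range (G.continuous_emb e)

theorem isConnected_range_emb (G : GraphLikeSpace X E) (e : E) : IsConnected (range (G.emb e)) :=
  isConnected_range (G.continuous_emb e)

theorem range_emb_subset_closure_inner (G : GraphLikeSpace X E) (e : E) :
    range (G.emb e) ⊆ closure (G.inner e) := by
  have h : closure (Ioo (0 : unitInterval) 1) = univ := by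
    rw [closure_Ioo zero_ne_one]
    exact eq_univ_of_forall fun t => ⟨t.2.1, t.2.2⟩
  rw [← image_univ, ← h]
  exact image_closure_subset_closure_image (G.continuous_emb e)

theorem isSub_range_emb (G : GraphLikeSpace X E) (e : E) : G.IsSub (range (G.emb e)) := by
  rintro e' ⟨x, hx, hx'⟩
  rw [eq_of_mem_inner_of_mem_range hx hx']

theorem range_emb_subset_compl_inner {e e' : E} (hne : e' ≠ e) :
    range (G.emb e') ⊆ (G.inner e)ᶜ := fun _ hx hx' =>
  hne (eq_of_mem_inner_of_mem_range hx' hx).symm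

theorem IsSub.diff_inner {Y : Set X} (hY : G.IsSub Y) (e : E) : G.IsSub (Y \ G.inner e) := by
  rintro e' ⟨x, hx, hxY, hxe⟩
  have hne : e' ≠ e := by rintro rfl; exact hxe hx
  exact subset_sdiff.2 ⟨hY e' ⟨x, hx, hxY⟩,
    subset_compl_iff_disjoint_right.1 (range_emb_subset_compl_inner hne)⟩

theorem IsSub.connectedComponentIn {Y : Set X} (hY : G.IsSub Y) (a : X) :
    G.IsSub (connectedComponentIn Y a) := by
  rintro e ⟨x, hx, hxY⟩
  rw [connectedComponentIn_eq hxY]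
  exact (G.isConnected_range_emb e).isPreconnected.subset_connectedComponentIn
    (G.inner_subset_range e hx) (hY e ⟨x, hx, connectedComponentIn_subset _ _ hxY⟩)

theorem IsSub.sInter {c : Set (Set X)} (hc : ∀ s ∈ c, G.IsSub s) : G.IsSub (⋂₀ c) := by
  rintro e ⟨x, hx, hxc⟩
  exact subset_sInter fun s hs => hc s hs e ⟨x, hx, hxc s hs⟩

theorem isSub_univ (G : GraphLikeSpace X E) : G.IsSub univ := fun _ _ => subset_univ _

theorem _root_.IsCompact.connectedComponentIn [T2Space X] {K : Set X} (hK : IsCompact K) (a : X) :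
    IsCompact (connectedComponentIn K a) := by
  by_cases ha : a ∈ K
  · refine hK.of_isClosed_subset (isClosed_of_closure_subset ?_) (connectedComponentIn_subset _ _)
    exact isPreconnected_connectedComponentIn.closure.subset_connectedComponentIn
      (subset_closure (mem_connectedComponentIn ha))
      (closure_minimal (connectedComponentIn_subset _ _) hK.isClosed)
  · rw [connectedComponentIn_eq_empty ha]
    exact isCompact_empty

/-- Zorn's lemma gives a minimal compact connected sub-graph-like space containing both vertices. If
removing one of its edges left `a` and `b` in one component, that component would be a smaller
candidate. -/
theorem exists_isPseudoArc_subset {Y : Set X} (hsub : G.IsSub Y) (hcomp : IsCompact Y)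
    (hconn : IsPreconnected Y) {a b : X} (ha : a ∈ G.verts) (hb : b ∈ G.verts) (haY : a ∈ Y)
    (hbY : b ∈ Y) : ∃ P ⊆ Y, G.IsPseudoArc P a b := by
  have := G.t2
  obtain ⟨P, hPY, hP⟩ := zorn_superset_nonempty
    {Z : Set X | G.IsSub Z ∧ IsCompact Z ∧ IsPreconnected Z ∧ a ∈ Z ∧ b ∈ Z} (by
      intro c hcS hc hne
      refine ⟨⋂₀ c, ⟨IsSub.sInter fun s hs => (hcS hs).1, ?_,
        isPreconnected_sInter_of_isChain hc hne (fun s hs => (hcS hs).2.1)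
          (fun s hs => (hcS hs).2.2.1), fun s hs => (hcS hs).2.2.2.1,
          fun s hs => (hcS hs).2.2.2.2⟩, fun s hs => sInter_subset_of_mem hs⟩
      obtain ⟨s, hs⟩ := hne
      exact (hcS hs).2.1.of_isClosed_subset
        (isClosed_sInter fun t ht => (hcS ht).2.1.isClosed) (sInter_subset_of_mem hs))
    Y ⟨hsub, hcomp, hconn, haY, hbY⟩
  obtain ⟨hPs, hPc, hPp, haP, hbP⟩ := hP.prop
  refine ⟨P, hPY, hPs, hPc, ⟨⟨a, haP⟩, hPp⟩, ha, hb, haP, hbP, fun e he hmem => ?_⟩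
  have haD : a ∈ P \ G.inner e := ⟨haP, fun h => notMem_verts_of_mem_inner h ha⟩
  have hle := hP.le_of_le (y := connectedComponentIn (P \ G.inner e) a)
    ⟨(hPs.diff_inner e).connectedComponentIn a,
      (hPc.diff (G.isOpen_inner e)).connectedComponentIn a,
      isPreconnected_connectedComponentIn, mem_connectedComponentIn haD, hmem⟩
    ((connectedComponentIn_subset _ _).trans sdiff_subset)
  obtain ⟨x, hx⟩ := G.inner_nonempty e
  exact (connectedComponentIn_subset _ _ (hle (he (G.inner_subset_range e hx)))).2 hx

theorem IsPseudoArc.symm {Y : Set X} {a b : X} (h : G.IsPseudoArc Y a b) : G.IsPseudoArc Y b a where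
  isSub := h.isSub
  isCompact := h.isCompact
  isConnected := h.isConnected
  start_vert := h.end_vert
  end_vert := h.start_vert
  start_mem := h.end_mem
  end_mem := h.start_mem
  separates e he hmem := by
    refine h.separates e he ?_
    rw [← connectedComponentIn_eq hmem]
    exact mem_connectedComponentIn ⟨h.end_mem, fun hb => notMem_verts_of_mem_inner hb h.end_vert⟩

theorem isPseudoArc_range_emb (G : GraphLikeSpace X E) {e : E} (he : G.emb e 0 ≠ G.emb e 1) :
    G.IsPseudoArc (range (G.emb e)) (G.emb e 0) (G.emb e 1) where
  isSub := G.isSub_range_emb e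
  isCompact := G.isCompact_range_emb e
  isConnected := G.isConnected_range_emb e
  start_vert := G.emb_zero_mem e
  end_vert := G.emb_one_mem e
  start_mem := mem_range_self _
  end_mem := mem_range_self _
  separates e' he' hmem := by
    have := G.t2
    obtain ⟨x, hx⟩ := G.inner_nonempty e'
    obtain rfl := eq_of_mem_inner_of_mem_range hx (he' (G.inner_subset_range e' hx))
    -- The only edge in the image is the edge itself, and without its inner points just two points
    -- remain.
    have hsub : range (G.emb e') \ G.inner e' ⊆ {G.emb e' 0, G.emb e' 1} :=
      sdiff_subset_iff.2 (G.range_emb_subset e')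
    have h0 : G.emb e' 0 ∈ range (G.emb e') \ G.inner e' :=
      ⟨mem_range_self _, fun h => notMem_verts_of_mem_inner h (G.emb_zero_mem e')⟩
    obtain ⟨U, V, hU, hV, h0U, h1V, hUV⟩ := t2_separation he
    have hC := (connectedComponentIn_subset _ (G.emb e' 0)).trans hsub
    have := (isPreconnected_connectedComponentIn (F := range (G.emb e') \ G.inner e')
      (x := G.emb e' 0)).subset_left_of_subset_union hU hV hUV (fun x hx => by
        rcases hC hx with rfl | rfl
        exacts [Or.inl h0U, Or.inr h1V]) ⟨_, mem_connectedComponentIn h0, h0U⟩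
    exact hUV.le_bot ⟨this hmem, h1V⟩

/-- `f` is a coordinate function of the edge `e` which separates the end-vertices of `e`: it is
the parameter on `e`, and takes only the values `0` and `1` elsewhere. -/
structure IsCut (G : GraphLikeSpace X E) (e : E) (f : X → unitInterval) : Prop where
  continuous : Continuous f
  emb : ∀ t, f (G.emb e t) = t
  zero_or_one : ∀ x ∉ G.inner e, f x = 0 ∨ f x = 1

/-! ### Cut functions and the two sides of an edge -/

namespace IsCut

variable {e : E} {f : X → unitInterval}

theorem mem_inner_iff (hf : G.IsCut e f) {x : X} :
    x ∈ G.inner e ↔ f x ∈ Ioo (0 : unitInterval) 1 := by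
  constructor
  · rintro ⟨t, ht, rfl⟩
    rwa [hf.emb]
  · intro h
    by_contra hx
    rcases hf.zero_or_one x hx with h' | h' <;> simp [h'] at h

theorem vert (hf : G.IsCut e f) {x : X} (hx : x ∈ G.verts) : f x = 0 ∨ f x = 1 :=
  hf.zero_or_one x fun h => notMem_verts_of_mem_inner h hx

theorem apply_eq (hf : G.IsCut e f) {s : Set X} (hs : IsPreconnected s)
    (hse : Disjoint (G.inner e) s) {x y : X} (hx : x ∈ s) (hy : y ∈ s) : f x = f y :=
  hs.apply_eq_of_zero_or_one hf.continuous
    (fun z hz => hf.zero_or_one z fun h => hse.le_bot ⟨h, hz⟩) hx hy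

theorem emb_eq (hf : G.IsCut e f) {e' : E} (hne : e' ≠ e) (s t : unitInterval) :
    f (G.emb e' s) = f (G.emb e' t) :=
  hf.apply_eq (G.isConnected_range_emb e').isPreconnected
    (subset_compl_iff_disjoint_left.1 (range_emb_subset_compl_inner hne)) (mem_range_self _)
    (mem_range_self _)

open Classical in
-- The map keeps the side `f = s` and collapses everything else to the end `G.emb e s`. It is
-- continuous because that end is the only possible frontier point of the side: the complement lies
-- in the closed union of the edge and the other side.
theorem continuous_retraction (hf : G.IsCut e f) {s : unitInterval} (hs : s = 0 ∨ s = 1) :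
    Continuous fun x => if f x = s then x else G.emb e s := by
  have := G.t2
  refine Continuous.if (fun x hx => ?_) continuous_id continuous_const
  have hcl : IsClosed {x | f x = s} := isClosed_eq hf.continuous continuous_const
  have hxs : f x = s := hcl.frontier_subset hx
  obtain ⟨s', hs', hss⟩ : ∃ s' : unitInterval, s ≠ s' ∧ ∀ t, t = 0 ∨ t = 1 → t ≠ s → t = s' := by
    rcases hs with rfl | rfl
    · exact ⟨1, zero_ne_one, fun t ht h => ht.resolve_left h⟩
    · exact ⟨0, one_ne_zero, fun t ht h => ht.resolve_right h⟩
  have hsub : {x | f x = s}ᶜ ⊆ range (G.emb e) ∪ {x | f x = s'} := by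
    intro y hy
    by_cases hye : y ∈ G.inner e
    · exact Or.inl (G.inner_subset_range e hye)
    · exact Or.inr (hss _ (hf.zero_or_one y hye) hy)
  have hx' : x ∈ closure {x | f x = s}ᶜ := by
    rw [frontier_eq_closure_inter_closure] at hx
    exact hx.2
  rcases closure_minimal hsub ((G.isCompact_range_emb e).isClosed.union
    (isClosed_eq hf.continuous continuous_const)) hx' with ⟨t, rfl⟩ | h
  · rw [hf.emb] at hxs
    rw [hxs]
  · exact absurd (hxs.symm.trans h) hs'

/-- If `P` contains `e`, the intersection is the image of `P` under the retraction; otherwise `f` is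
constant on `P`. -/
theorem isPreconnected_inter (hf : G.IsCut e f) {P : Set X} (hP : G.IsSub P)
    (hPc : IsPreconnected P) {s : unitInterval} (hs : s = 0 ∨ s = 1) :
    IsPreconnected (P ∩ {x | f x = s}) := by
  classical
  by_cases he : (G.inner e ∩ P).Nonempty
  · convert hPc.image _ (hf.continuous_retraction hs).continuousOn using 1
    ext x
    constructor
    · rintro ⟨hx, hxs⟩
      exact ⟨x, hx, if_pos hxs⟩
    · rintro ⟨y, hy, rfl⟩
      by_cases h : f y = s
      · simp [h, hy]
      · simp only [if_neg h]
        exact ⟨hP e he (mem_range_self _), hf.emb s⟩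
  · have hd : Disjoint (G.inner e) P := disjoint_iff_inter_eq_empty.2 (not_nonempty_iff_eq_empty.1 he)
    by_cases hne : (P ∩ {x | f x = s}).Nonempty
    · obtain ⟨x, hx, hxs⟩ := hne
      have hsub : P ⊆ {x | f x = s} := fun y hy => (hf.apply_eq hPc hd hy hx).trans hxs
      rwa [inter_eq_left.2 hsub]
    · rw [not_nonempty_iff_eq_empty.1 hne]
      exact isPreconnected_empty

theorem isSub_inter (hf : G.IsCut e f) {P : Set X} (hP : G.IsSub P) {s : unitInterval}
    (hs : s = 0 ∨ s = 1) : G.IsSub (P ∩ {x | f x = s}) := by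
  rintro e' ⟨x, hx, hxP, hxs⟩
  have hne : e' ≠ e := by
    rintro rfl
    have := hf.mem_inner_iff.1 hx
    rw [mem_ofPred_eq] at hxs
    rcases hs with rfl | rfl <;> simp [hxs] at this
  refine subset_inter (hP e' ⟨x, hx, hxP⟩) ?_
  obtain ⟨t, -, rfl⟩ := hx
  rintro _ ⟨t', rfl⟩
  exact (hf.emb_eq hne t' t).trans hxs

end IsCut

/-! ### Cut functions and arcs in tree-like spaces -/

namespace IsTreeLike

theorem isPseudoArc_arc (h : G.IsTreeLike) {a b : X} (ha : a ∈ G.verts) (hb : b ∈ G.verts) :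
    G.IsPseudoArc (G.arc a b) a b := by
  have hex := (h.existsUnique_arc a ha b hb).exists
  rw [arc, dif_pos hex]
  exact hex.choose_spec

theorem eq_arc (h : G.IsTreeLike) {a b : X} {Y : Set X} (hY : G.IsPseudoArc Y a b) :
    Y = G.arc a b :=
  (h.existsUnique_arc a hY.start_vert b hY.end_vert).unique hY
    (h.isPseudoArc_arc hY.start_vert hY.end_vert)

theorem arc_subset (h : G.IsTreeLike) {Y : Set X} (hsub : G.IsSub Y) (hcomp : IsCompact Y)
    (hconn : IsPreconnected Y) {a b : X} (ha : a ∈ G.verts) (hb : b ∈ G.verts) (haY : a ∈ Y)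
    (hbY : b ∈ Y) : G.arc a b ⊆ Y := by
  obtain ⟨P, hPY, hP⟩ := exists_isPseudoArc_subset hsub hcomp hconn ha hb haY hbY
  rwa [← h.eq_arc hP]

theorem exists_isCut (h : G.IsTreeLike) (e : E) : ∃ f, G.IsCut e f := by
  have := G.t2
  have := h.compact
  set K := (G.inner e)ᶜ with hKdef
  have hKc : IsClosed K := (G.isOpen_inner e).isClosed_compl
  have h0 : G.emb e 0 ∈ K := fun hm => notMem_verts_of_mem_inner hm (G.emb_zero_mem e)
  have h1 : G.emb e 1 ∈ K := fun hm => notMem_verts_of_mem_inner hm (G.emb_one_mem e)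
  -- Otherwise the component would contain the unique arc between the ends of `e`, which is the edge
  -- itself.
  have hnot : G.emb e 1 ∉ connectedComponentIn K (G.emb e 0) := by
    intro hmem
    have hKs : G.IsSub K := by
      rw [hKdef, compl_eq_univ_sdiff]
      exact G.isSub_univ.diff_inner e
    have hle := h.arc_subset (hKs.connectedComponentIn (G.emb e 0))
      (hKc.isCompact.connectedComponentIn _) isPreconnected_connectedComponentIn
      (G.emb_zero_mem e) (G.emb_one_mem e) (mem_connectedComponentIn h0) hmem
    rw [← h.eq_arc (G.isPseudoArc_range_emb (h.loopFree e))] at hle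
    obtain ⟨x, hx⟩ := G.inner_nonempty e
    exact connectedComponentIn_subset _ _ (hle (G.inner_subset_range e hx)) hx
  have : CompactSpace K := isCompact_iff_compactSpace.1 hKc.isCompact
  -- In a compact Hausdorff space components are intersections of clopen sets, so some clopen `Z`
  -- separates the two ends.
  rw [connectedComponentIn_eq_image h0, connectedComponent_eq_iInter_isClopen] at hnot
  obtain ⟨Z, hZ, h0Z, h1Z⟩ : ∃ Z : Set K, IsClopen Z ∧ ⟨_, h0⟩ ∈ Z ∧ ⟨_, h1⟩ ∉ Z := by
    by_contra! hcon
    exact hnot ⟨⟨_, h1⟩, mem_iInter.2 fun Z => hcon Z.1 Z.2.1 Z.2.2, rfl⟩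
  have hA : IsClosed (Subtype.val '' Z) := hKc.isClosedMap_subtype_val _ hZ.1
  have hB : IsClosed (Subtype.val '' Zᶜ) := hKc.isClosedMap_subtype_val _ hZ.compl.1
  have hex : ∀ x, ∃ t : unitInterval, (x ∈ G.inner e → G.emb e t = x) ∧
      (x ∈ Subtype.val '' Z → t = 0) ∧ (x ∈ Subtype.val '' Zᶜ → t = 1) := by
    intro x
    by_cases hx : x ∈ G.inner e
    · obtain ⟨t, -, rfl⟩ := id hx
      refine ⟨t, fun _ => rfl, ?_, ?_⟩ <;>
      · rintro ⟨y, -, hy⟩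
        exact absurd (hy ▸ hx) y.2
    · by_cases hxZ : (⟨x, hx⟩ : K) ∈ Z
      · refine ⟨0, fun h => absurd h hx, fun _ => rfl, ?_⟩
        rintro ⟨y, hy, rfl⟩
        exact absurd hxZ hy
      · refine ⟨1, fun h => absurd h hx, ?_, fun _ => rfl⟩
        rintro ⟨y, hy, rfl⟩
        exact absurd hy hxZ
  choose f hfe hfA hfB using hex
  have hK : ∀ x ∉ G.inner e, x ∈ Subtype.val '' Z ∨ x ∈ Subtype.val '' Zᶜ := by
    intro x hx
    by_cases hxZ : (⟨x, hx⟩ : K) ∈ Z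
    · exact Or.inl ⟨_, hxZ, rfl⟩
    · exact Or.inr ⟨_, hxZ, rfl⟩
  have hemb : ∀ t, f (G.emb e t) = t := by
    intro t
    by_cases ht : t ∈ Ioo (0 : unitInterval) 1
    · have hin : G.emb e t ∈ G.inner e := mem_image_of_mem _ ht
      have heq := hfe _ hin
      by_cases hft : f (G.emb e t) ∈ Ioo (0 : unitInterval) 1
      · exact (G.inner_inj e e _ hft _ ht heq).2
      · rcases unitInterval.eq_zero_or_one_of_notMem_Ioo hft with h' | h'
        · rw [h'] at heq
          exact absurd (heq ▸ G.emb_zero_mem e) (notMem_verts_of_mem_inner hin)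
        · rw [h'] at heq
          exact absurd (heq ▸ G.emb_one_mem e) (notMem_verts_of_mem_inner hin)
    · rcases unitInterval.eq_zero_or_one_of_notMem_Ioo ht with rfl | rfl
      · exact hfA _ ⟨_, h0Z, rfl⟩
      · exact hfB _ ⟨_, h1Z, rfl⟩
  refine ⟨f, ⟨continuous_iff_isClosed.2 fun C hC => ?_, hemb,
    fun x hx => (hK x hx).imp (hfA x) (hfB x)⟩⟩
  have hpre : f ⁻¹' C = G.emb e '' C ∪ ({x | x ∈ Subtype.val '' Z ∧ (0 : unitInterval) ∈ C} ∪
      {x | x ∈ Subtype.val '' Zᶜ ∧ (1 : unitInterval) ∈ C}) := by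
    ext x
    constructor
    · intro hx
      by_cases hxe : x ∈ G.inner e
      · exact Or.inl ⟨f x, hx, hfe x hxe⟩
      · refine Or.inr ((hK x hxe).imp (fun h => ⟨h, ?_⟩) fun h => ⟨h, ?_⟩)
        · rw [← hfA x h]; exact hx
        · rw [← hfB x h]; exact hx
    · rintro (⟨t, ht, rfl⟩ | ⟨hx, hC⟩ | ⟨hx, hC⟩)
      · rwa [mem_preimage, hemb]
      · rwa [mem_preimage, hfA x hx]
      · rwa [mem_preimage, hfB x hx]
  rw [hpre]
  exact (hC.isCompact.image (G.continuous_emb e)).isClosed.union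
    ((hA.inter isClosed_const).union (hB.inter isClosed_const))

/-- Cutting the arc down to the side of `a` leaves a compact connected sub-graph-like space
containing both vertices, hence the whole arc. -/
theorem disjoint_inner_arc (h : G.IsTreeLike) {e : E} {f : X → unitInterval} (hf : G.IsCut e f)
    {a b : X} (ha : a ∈ G.verts) (hb : b ∈ G.verts) (hab : f a = f b) :
    Disjoint (G.inner e) (G.arc a b) := by
  have := G.t2
  have hP := h.isPseudoArc_arc ha hb
  have hsub := h.arc_subset (hf.isSub_inter hP.isSub (hf.vert ha))
    (hP.isCompact.inter_right (isClosed_eq hf.continuous continuous_const))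
    (hf.isPreconnected_inter hP.isSub hP.isConnected.isPreconnected (hf.vert ha)) ha hb
    ⟨hP.start_mem, rfl⟩ ⟨hP.end_mem, hab.symm⟩
  refine disjoint_left.2 fun x hx hxP => ?_
  have h1 : f x = f a := (hsub hxP).2
  have h2 := hf.mem_inner_iff.1 hx
  rw [h1] at h2
  rcases hf.vert ha with h' | h' <;> simp [h'] at h2

theorem range_emb_subset_arc (h : G.IsTreeLike) {e : E} {f : X → unitInterval} (hf : G.IsCut e f)
    {a b : X} (ha : a ∈ G.verts) (hb : b ∈ G.verts) (hab : f a ≠ f b) :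
    range (G.emb e) ⊆ G.arc a b := by
  have hP := h.isPseudoArc_arc ha hb
  refine hP.isSub e (not_disjoint_iff_nonempty_inter.1 fun hd => hab ?_)
  exact hf.apply_eq hP.isConnected.isPreconnected hd hP.start_mem hP.end_mem

theorem range_emb_subset_arc_iff (h : G.IsTreeLike) {e : E} {f : X → unitInterval}
    (hf : G.IsCut e f) {a b : X} (ha : a ∈ G.verts) (hb : b ∈ G.verts) :
    range (G.emb e) ⊆ G.arc a b ↔ f a ≠ f b := by
  refine ⟨fun hsub hab => ?_, h.range_emb_subset_arc hf ha hb⟩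
  obtain ⟨x, hx⟩ := G.inner_nonempty e
  exact (h.disjoint_inner_arc hf ha hb hab).le_bot ⟨hx, hsub (G.inner_subset_range e hx)⟩

theorem arc_subset_arc (h : G.IsTreeLike) {a b c d : X} (ha : a ∈ G.verts) (hb : b ∈ G.verts)
    (hc : c ∈ G.verts) (hd : d ∈ G.verts) (hacd : a ∈ G.arc c d) (hbcd : b ∈ G.arc c d) :
    G.arc a b ⊆ G.arc c d :=
  have hP := h.isPseudoArc_arc hc hd
  h.arc_subset hP.isSub hP.isCompact hP.isConnected.isPreconnected ha hb hacd hbcd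

end IsTreeLike

/-- The pair `p` is an orientation of the edge `e`. -/
def OrientedEdge.IsOn (p : G.OrientedEdge) (e : E) : Prop :=
  (p.tail = G.emb e 0 ∧ p.head = G.emb e 1) ∨ (p.tail = G.emb e 1 ∧ p.head = G.emb e 0)

/-! ### The order in terms of sides of edges -/

namespace OrientedEdge

variable {p q : G.OrientedEdge} {e e' : E}

theorem tail_mem (p : G.OrientedEdge) : p.tail ∈ G.verts := by
  obtain ⟨e, h | h⟩ := p.isEdge <;> rw [h.1]
  exacts [G.emb_zero_mem e, G.emb_one_mem e]

theorem head_mem (p : G.OrientedEdge) : p.head ∈ G.verts := p.inv.tail_mem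

theorem IsOn.inv (hp : p.IsOn e) : p.inv.IsOn e :=
  hp.symm.imp And.symm And.symm

theorem IsOn.tail_mem_range (hp : p.IsOn e) : p.tail ∈ range (G.emb e) := by
  rcases hp with hp | hp <;> rw [hp.1] <;> exact mem_range_self _

theorem IsOn.head_mem_range (hp : p.IsOn e) : p.head ∈ range (G.emb e) := hp.inv.tail_mem_range

theorem IsOn.tail_ne_head (h : G.IsTreeLike) (hp : p.IsOn e) : p.tail ≠ p.head := by
  rcases hp with hp | hp <;> rw [hp.1, hp.2]
  exacts [h.loopFree e, (h.loopFree e).symm]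

theorem IsOn.cut_ne {f : X → unitInterval} (hf : G.IsCut e f) (hp : p.IsOn e) :
    f p.tail ≠ f p.head := by
  rcases hp with hp | hp <;> simp [hp.1, hp.2, hf.emb]

theorem IsOn.cut_eq_tail_or_head {f : X → unitInterval} (hf : G.IsCut e f) (hp : p.IsOn e) {u : X}
    (hu : u ∈ G.verts) : f u = f p.tail ∨ f u = f p.head := by
  have := hf.vert hu
  rcases hp with hp | hp <;> rw [hp.1, hp.2, hf.emb, hf.emb]
  exacts [this, this.symm]

theorem IsOn.range_eq_arc (h : G.IsTreeLike) (hp : p.IsOn e) :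
    range (G.emb e) = G.arc p.tail p.head := by
  have := G.isPseudoArc_range_emb (h.loopFree e)
  rcases hp with hp | hp <;> rw [hp.1, hp.2]
  exacts [h.eq_arc this, h.eq_arc this.symm]

/-- There are no parallel edges: both would be the unique arc between their common ends. -/
theorem IsOn.edge_unique (h : G.IsTreeLike) (hp : p.IsOn e) (hp' : p.IsOn e') : e = e' := by
  obtain ⟨x, hx⟩ := G.inner_nonempty e
  refine eq_of_mem_inner_of_mem_range hx ?_
  rw [hp'.range_eq_arc h, ← hp.range_eq_arc h]
  exact G.inner_subset_range e hx

theorem IsOn.eq_or_eq_inv (hp : p.IsOn e) (hq : q.IsOn e) : q = p ∨ q = p.inv := by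
  rcases hp with hp | hp <;> rcases hq with hq | hq
  · exact Or.inl (OrientedEdge.ext (hq.1.trans hp.1.symm) (hq.2.trans hp.2.symm))
  · exact Or.inr (OrientedEdge.ext (hq.1.trans hp.2.symm) (hq.2.trans hp.1.symm))
  · exact Or.inr (OrientedEdge.ext (hq.1.trans hp.2.symm) (hq.2.trans hp.1.symm))
  · exact Or.inl (OrientedEdge.ext (hq.1.trans hp.1.symm) (hq.2.trans hp.2.symm))

theorem pair_eq_iff : ({p.tail, p.head} : Set X) = {q.tail, q.head} ↔ q = p ∨ q = p.inv := by
  rw [pair_eq_pair_iff, OrientedEdge.ext_iff, OrientedEdge.ext_iff]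
  simp only [OrientedEdge.inv]
  grind

/-- The first inclusion says that `q.tail` is on the head side of `p`: on the tail side, the arc
from `p.head` would use `e` while the arc from `p.tail` would not. Conversely, an arc through `e`
contains `p.head`. In the same way the second inclusion says that `p.tail` is on the tail side of
`q`. -/
theorem le_iff (h : G.IsTreeLike) {f f' : X → unitInterval} (hf : G.IsCut e f)
    (hf' : G.IsCut e' f') (hp : p.IsOn e) (hq : q.IsOn e') :
    p ≤ q ↔ p = q ∨ (¬ (q = p ∨ q = p.inv) ∧ f q.tail = f p.head ∧ f' p.tail = f' q.tail) := by
  have hpt := p.tail_mem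
  have hph := p.head_mem
  have hqt := q.tail_mem
  have hqh := q.head_mem
  change p = q ∨ (({p.tail, p.head} : Set X) ≠ {q.tail, q.head} ∧ _) ↔ _
  rw [Ne, pair_eq_iff]
  refine or_congr_right (and_congr_right fun _ => ⟨fun ⟨h1, h2⟩ => ⟨?_, ?_⟩, fun ⟨h1, h2⟩ => ⟨?_, ?_⟩⟩)
  · by_contra hne
    have h3 := (hp.cut_eq_tail_or_head hf hqt).resolve_right hne
    exact (h.range_emb_subset_arc_iff hf hpt hqt).1
      ((h.range_emb_subset_arc hf hph hqt (Ne.symm hne)).trans h1) h3.symm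
  · by_contra hne
    have h3 := (hq.cut_eq_tail_or_head hf' hpt).resolve_left hne
    exact (h.range_emb_subset_arc_iff hf' hpt hqh).1
      ((h.range_emb_subset_arc hf' hpt hqt hne).trans h2) h3
  · have hne : f p.tail ≠ f q.tail := h1 ▸ hp.cut_ne hf
    exact h.arc_subset_arc hph hqt hpt hqt (h.range_emb_subset_arc hf hpt hqt hne hp.head_mem_range)
      (h.isPseudoArc_arc hpt hqt).end_mem
  · have hne : f' p.tail ≠ f' q.head := h2 ▸ hq.cut_ne hf'
    exact h.arc_subset_arc hpt hqt hpt hqh (h.isPseudoArc_arc hpt hqh).start_mem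
      (h.range_emb_subset_arc hf' hpt hqh hne hq.tail_mem_range)

end OrientedEdge

/-! ### Uncontracted edges in the contraction -/

section Contraction

variable {X : Type u} {E : Type v} [TopologicalSpace X] {G : GraphLikeSpace X E} {F : Set E}
  {e e' : E} {f : X → unitInterval}

theorem continuous_toContraction (G : GraphLikeSpace X E) (F : Set E) :
    Continuous (G.toContraction F) := continuous_quotient_mk'

theorem toContraction_surjective (G : GraphLikeSpace X E) (F : Set E) :
    Function.Surjective (G.toContraction F) := Quotient.mk_surjective

theorem t2Space_contraction (G : GraphLikeSpace X E) (F : Set E) : T2Space (G.Contraction F) :=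
  (G.contractionSetoid_isLeast F).1.1

theorem toContraction_emb_eq (he : e ∈ F) (s t : unitInterval) :
    G.toContraction F (G.emb e s) = G.toContraction F (G.emb e t) :=
  Quotient.sound ((G.contractionSetoid_isLeast F).1.2 e he s t)

/-- The quotient by the kernel injects continuously into [0,1], so it is Hausdorff, and `f` is
constant on every other edge. -/
theorem IsCut.ker_mem_contractionSetoids (hf : G.IsCut e f) (he : e ∉ F) :
    Setoid.ker f ∈ G.contractionSetoids F := by
  refine ⟨?_, fun e' he' s t => hf.emb_eq (fun h => he (h ▸ he')) s t⟩
  exact T2Space.of_injective_continuous (Setoid.kerLift_injective f)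
    (hf.continuous.quotient_lift _)

theorem IsCut.exists_contraction_map (hf : G.IsCut e f) (he : e ∉ F) :
    ∃ g : G.Contraction F → unitInterval, Continuous g ∧ ∀ x, g (G.toContraction F x) = f x := by
  have hle : G.contractionSetoid F ≤ Setoid.ker f :=
    (G.contractionSetoid_isLeast F).2 (hf.ker_mem_contractionSetoids he)
  exact ⟨Quotient.lift f fun a b hab => hle hab, hf.continuous.quotient_lift _, fun x => rfl⟩

theorem IsCut.emb_apply (hf : G.IsCut e f) {x : X} (hx : x ∈ G.inner e) : G.emb e (f x) = x := by
  obtain ⟨t, -, rfl⟩ := hx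
  rw [hf.emb]

/-- The value of `f` depends only on the class, and a value strictly between 0 and 1 determines the
point. -/
theorem IsCut.eq_of_toContraction_eq (hf : G.IsCut e f) (he : e ∉ F) {x y : X}
    (hx : x ∈ G.inner e) (hxy : G.toContraction F x = G.toContraction F y) : x = y := by
  obtain ⟨g, -, hg⟩ := hf.exists_contraction_map he
  have h : f x = f y := by rw [← hg, ← hg, hxy]
  have hy : y ∈ G.inner e := hf.mem_inner_iff.2 (h ▸ hf.mem_inner_iff.1 hx)
  rw [← hf.emb_apply hx, ← hf.emb_apply hy, h]

namespace IsTreeLike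

theorem eq_of_toContraction_eq (h : G.IsTreeLike) (he : e ∉ F) {x y : X}
    (hx : x ∈ G.inner e) (hxy : G.toContraction F x = G.toContraction F y) : x = y := by
  obtain ⟨f, hf⟩ := h.exists_isCut e
  exact hf.eq_of_toContraction_eq he hx hxy

theorem isOpen_image_inner (h : G.IsTreeLike) (he : e ∉ F) :
    IsOpen (G.toContraction F '' G.inner e) := by
  obtain ⟨f, hf⟩ := h.exists_isCut e
  obtain ⟨g, hgc, hg⟩ := hf.exists_contraction_map he
  convert isOpen_Ioo.preimage hgc (t := Ioo (0 : unitInterval) 1) using 1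
  ext z
  obtain ⟨x, rfl⟩ := G.toContraction_surjective F z
  rw [mem_preimage, hg, ← hf.mem_inner_iff]
  refine ⟨?_, mem_image_of_mem _⟩
  rintro ⟨y, hy, hyx⟩
  rwa [← hf.eq_of_toContraction_eq he hy hyx]

theorem pairwise_disjoint_image_inner (h : G.IsTreeLike) (F : Set E) :
    Pairwise fun i j : {e // e ∉ F} =>
      Disjoint (G.toContraction F '' G.inner i) (G.toContraction F '' G.inner j) := by
  rintro ⟨i, hi⟩ ⟨j, hj⟩ hne
  refine disjoint_left.2 ?_
  rintro _ ⟨x, hx, rfl⟩ ⟨y, hy, hyx⟩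
  obtain rfl := h.eq_of_toContraction_eq hj hy hyx
  exact hne (Subtype.ext (eq_of_mem_inner hx hy))

theorem eq_of_image_inner_eq (h : G.IsTreeLike) (he' : e' ∉ F)
    (heq : G.toContraction F '' G.inner e = G.toContraction F '' G.inner e') : e = e' := by
  obtain ⟨x, hx⟩ := G.inner_nonempty e
  obtain ⟨y, hy, hyx⟩ := heq ▸ mem_image_of_mem (G.toContraction F) hx
  obtain rfl := h.eq_of_toContraction_eq he' hy hyx
  exact eq_of_mem_inner hx hy

theorem notMem_contractionVerts (h : G.IsTreeLike) (he : e ∉ F) {z : G.Contraction F}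
    (hz : z ∈ G.toContraction F '' G.inner e) : z ∉ G.contractionVerts F := by
  obtain ⟨x, hx, rfl⟩ := hz
  rintro ⟨y, hy, hyx⟩
  obtain rfl := h.eq_of_toContraction_eq he hx hyx.symm
  exact notMem_verts_of_mem_inner hx hy

end IsTreeLike

theorem exists_mem_image_inner {z : G.Contraction F} (hz : z ∉ G.contractionVerts F) :
    ∃ e ∉ F, z ∈ G.toContraction F '' G.inner e := by
  obtain ⟨x, rfl⟩ := G.toContraction_surjective F z
  obtain ⟨e, he⟩ := G.exists_mem_inner (x := x) fun hx => hz (mem_image_of_mem _ hx)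
  -- An inner point of a contracted edge has the class of an end-vertex.
  refine ⟨e, fun heF => hz ⟨G.emb e 0, G.emb_zero_mem e, ?_⟩, mem_image_of_mem _ he⟩
  obtain ⟨t, -, rfl⟩ := he
  exact toContraction_emb_eq heF 0 t

end Contraction

/-! ### Transfer of edges, sides and order to a minor -/

section Minor

variable {X₁ E₁ X₂ E₂ : Type*} [TopologicalSpace X₁] [TopologicalSpace X₂]
  {T₁ : GraphLikeSpace X₁ E₁} {T₂ : GraphLikeSpace X₂ E₂} {F₁ F₂ : Set E₂}
  {W : Set (T₂.Contraction F₁)} {φ : X₁ ≃ₜ T₂.minorPoints F₁ F₂ W}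

/-- On both sides the non-vertices are partitioned into connected open edge interiors. So the image
of `T₁.inner d` lies in one interior, and the inverse of `φ` carries that interior back into a
single one. -/
theorem exists_image_inner_eq (h₂ : T₂.IsTreeLike) (hW : W ⊆ T₂.contractionVerts F₁)
    (hφ : ∀ x, x ∈ T₁.verts ↔ (φ x : T₂.Contraction F₁) ∈ T₂.contractionVerts F₁) (d : E₁) :
    ∃ e ∉ F₁, (fun x => (φ x : T₂.Contraction F₁)) '' T₁.inner d =
      T₂.toContraction F₁ '' T₂.inner e := by
  set ψ : X₁ → T₂.Contraction F₁ := fun x => φ x with hψ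
  have hψc : Continuous ψ := continuous_subtype_val.comp φ.continuous
  obtain ⟨x₀, hx₀⟩ := T₁.inner_nonempty d
  have hnv : ∀ x, x ∉ T₁.verts → ∃ e ∉ F₁, ψ x ∈ T₂.toContraction F₁ '' T₂.inner e :=
    fun x hx => exists_mem_image_inner fun h => hx ((hφ x).2 h)
  obtain ⟨e, he, hxe⟩ := hnv x₀ (notMem_verts_of_mem_inner hx₀)
  refine ⟨e, he, subset_antisymm ?_ ?_⟩
  · refine IsPreconnected.subset_of_pairwise_disjoint_isOpen
      (U := fun i : {e // e ∉ F₁} => T₂.toContraction F₁ '' T₂.inner i) (i := ⟨e, he⟩)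
      ((T₁.isPreconnected_inner d).image ψ hψc.continuousOn)
      (fun i => h₂.isOpen_image_inner i.2) (h₂.pairwise_disjoint_image_inner F₁) ?_
      ⟨ψ x₀, mem_image_of_mem _ hx₀, hxe⟩
    rintro _ ⟨x, hx, rfl⟩
    obtain ⟨e', he', hxe'⟩ := hnv x (notMem_verts_of_mem_inner hx)
    exact mem_iUnion.2 ⟨⟨e', he'⟩, hxe'⟩
  -- The edge `e` contains a point of the minor, so it is not deleted, and its inner points, not
  -- being vertices, avoid `W`.
  · have heF₂ : e ∉ F₂ := fun heF => (φ x₀).2.1 e heF hxe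
    have hmem : ∀ z ∈ T₂.toContraction F₁ '' T₂.inner e, z ∈ T₂.minorPoints F₁ F₂ W := by
      intro z hz
      refine ⟨fun e' he' hz' => ?_, fun hzW => h₂.notMem_contractionVerts he hz (hW hzW)⟩
      obtain ⟨x, hx, rfl⟩ := hz
      obtain ⟨y, hy, hyx⟩ := hz'
      obtain rfl := h₂.eq_of_toContraction_eq he hx hyx.symm
      exact heF₂ (eq_of_mem_inner hx hy ▸ he')
    set A : Set (T₂.minorPoints F₁ F₂ W) := Subtype.val ⁻¹' (T₂.toContraction F₁ '' T₂.inner e)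
    have hA : IsPreconnected A := by
      rw [← Topology.IsInducing.subtypeVal.isPreconnected_image,
        image_preimage_eq_of_subset fun z hz => ⟨⟨z, hmem z hz⟩, rfl⟩]
      exact (T₂.isPreconnected_inner e).image _ (T₂.continuous_toContraction F₁).continuousOn
    have hsub : φ.symm '' A ⊆ T₁.inner d := by
      refine IsPreconnected.subset_of_pairwise_disjoint_isOpen
        (hA.image _ φ.symm.continuous.continuousOn) T₁.isOpen_inner T₁.pairwise_disjoint_inner ?_
        ⟨x₀, ⟨φ x₀, hxe, φ.symm_apply_apply x₀⟩, hx₀⟩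
      rintro _ ⟨z, hz, rfl⟩
      refine mem_iUnion.2 (T₁.exists_mem_inner fun hv => ?_)
      have := (hφ _).1 hv
      rw [φ.apply_symm_apply] at this
      exact h₂.notMem_contractionVerts he hz this
    intro z hz
    exact ⟨φ.symm ⟨z, hmem z hz⟩, hsub ⟨⟨z, hmem z hz⟩, hz, rfl⟩, by simp [hψ]⟩

/-- The oriented edge `p` of `T₁` corresponds, under a map `ψ` from `T₁` to the contraction
`T₂/F`, to the oriented edge `p'` of `T₂`. -/
structure Corresponds (T₁ : GraphLikeSpace X₁ E₁) (T₂ : GraphLikeSpace X₂ E₂) {F : Set E₂}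
    (ψ : X₁ → T₂.Contraction F) (d : E₁) (e : E₂) (p : T₁.OrientedEdge) (p' : T₂.OrientedEdge) :
    Prop where
  isOn : p.IsOn d
  isOn' : p'.IsOn e
  notMem : e ∉ F
  image_inner : ψ '' T₁.inner d = T₂.toContraction F '' T₂.inner e
  tail : ψ p.tail = T₂.toContraction F p'.tail
  head : ψ p.head = T₂.toContraction F p'.head

namespace Corresponds

variable {F : Set E₂} {ψ : X₁ → T₂.Contraction F} {d : E₁} {e : E₂} {p q : T₁.OrientedEdge}
  {p' q' : T₂.OrientedEdge} {d' : E₁} {e' : E₂}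

theorem inv (h : Corresponds T₁ T₂ ψ d e p p') : Corresponds T₁ T₂ ψ d e p.inv p'.inv :=
  ⟨h.isOn.inv, h.isOn'.inv, h.notMem, h.image_inner, h.head, h.tail⟩

theorem left_unique (hψ : Function.Injective ψ) (h : Corresponds T₁ T₂ ψ d e p p')
    (h' : Corresponds T₁ T₂ ψ d' e' q p') : p = q :=
  OrientedEdge.ext (hψ (h.tail.trans h'.tail.symm)) (hψ (h.head.trans h'.head.symm))

theorem right_unique (h₁ : T₁.IsTreeLike) (h₂ : T₂.IsTreeLike) (hψ : Function.Injective ψ)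
    (h : Corresponds T₁ T₂ ψ d e p p') (h' : Corresponds T₁ T₂ ψ d' e' p q') : p' = q' := by
  obtain rfl := h.isOn.edge_unique h₁ h'.isOn
  obtain rfl := h₂.eq_of_image_inner_eq h'.notMem (h.image_inner.symm.trans h'.image_inner)
  rcases h.isOn'.eq_or_eq_inv h'.isOn' with rfl | rfl
  · rfl
  · exact absurd (hψ (h.tail.trans h'.head.symm)) (h.isOn.tail_ne_head h₁)

/-- The arc from `u` to `p.head` avoids `d`, so its image avoids the interior of `e`. There the
descended cut function takes only the values 0 and 1, and by connectedness it is constant. -/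
theorem cut_eq_head (h₁ : T₁.IsTreeLike) (hψ : Function.Injective ψ) (hψc : Continuous ψ)
    (h : Corresponds T₁ T₂ ψ d e p p') {f : X₁ → unitInterval} {f' : X₂ → unitInterval}
    (hf : T₁.IsCut d f) (hf' : T₂.IsCut e f') {u : X₁} {u' : X₂} (hu : u ∈ T₁.verts)
    (huu : ψ u = T₂.toContraction F u') (heq : f u = f p.head) : f' u' = f' p'.head := by
  obtain ⟨g, hgc, hg⟩ := hf'.exists_contraction_map h.notMem
  rw [← hg, ← hg, ← huu, ← h.head]
  have hP := h₁.isPseudoArc_arc hu p.head_mem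
  refine hP.isConnected.isPreconnected.apply_eq_of_zero_or_one (hgc.comp hψc) (fun x hx => ?_)
    hP.start_mem hP.end_mem
  obtain ⟨y, hy⟩ := T₂.toContraction_surjective F (ψ x)
  rw [Function.comp_apply, ← hy, hg]
  refine hf'.zero_or_one y fun hye => ?_
  obtain ⟨x', hx', hxx⟩ := h.image_inner.symm ▸ mem_image_of_mem (T₂.toContraction F) hye
  obtain rfl := hψ (hxx.trans hy)
  exact (h₁.disjoint_inner_arc hf hu p.head_mem heq).le_bot ⟨hx', hx⟩

theorem cut_eq_head_iff (h₁ : T₁.IsTreeLike) (hψ : Function.Injective ψ) (hψc : Continuous ψ)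
    (h : Corresponds T₁ T₂ ψ d e p p') {f : X₁ → unitInterval} {f' : X₂ → unitInterval}
    (hf : T₁.IsCut d f) (hf' : T₂.IsCut e f') {u : X₁} {u' : X₂} (hu : u ∈ T₁.verts)
    (huu : ψ u = T₂.toContraction F u') : f u = f p.head ↔ f' u' = f' p'.head := by
  refine ⟨h.cut_eq_head h₁ hψ hψc hf hf' hu huu, fun heq => ?_⟩
  -- There are only two sides, so the converse is the forward direction for the reversed edge.
  refine (h.isOn.cut_eq_tail_or_head hf hu).resolve_left fun hne => ?_
  exact h.isOn'.cut_ne hf' ((h.inv.cut_eq_head h₁ hψ hψc hf hf' hu huu hne).symm.trans heq)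

theorem le_iff (h₁ : T₁.IsTreeLike) (h₂ : T₂.IsTreeLike) (hψ : Function.Injective ψ)
    (hψc : Continuous ψ) (h : Corresponds T₁ T₂ ψ d e p p')
    (h' : Corresponds T₁ T₂ ψ d' e' q q') : p ≤ q ↔ p' ≤ q' := by
  have huniq : ∀ {a b a' b' i j k l}, Corresponds T₁ T₂ ψ i j a a' →
      Corresponds T₁ T₂ ψ k l b b' → (a = b ↔ a' = b') := by
    intro a b a' b' i j k l ha hb
    constructor
    · rintro rfl
      exact ha.right_unique h₁ h₂ hψ hb
    · rintro rfl
      exact ha.left_unique hψ hb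
  obtain ⟨f, hf⟩ := h₁.exists_isCut d
  obtain ⟨g, hg⟩ := h₁.exists_isCut d'
  obtain ⟨f', hf'⟩ := h₂.exists_isCut e
  obtain ⟨g', hg'⟩ := h₂.exists_isCut e'
  rw [OrientedEdge.le_iff h₁ hf hg h.isOn h'.isOn, OrientedEdge.le_iff h₂ hf' hg' h.isOn' h'.isOn',
    huniq h h', huniq h' h, huniq h' h.inv,
    h.cut_eq_head_iff h₁ hψ hψc hf hf' q.tail_mem h'.tail]
  have := h'.inv.cut_eq_head_iff h₁ hψ hψc hg hg' p.tail_mem h.tail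
  rw [show g p.tail = g q.tail ↔ g' p'.tail = g' q'.tail from this]

end Corresponds

/-- An edge lies in the closure of its interior, so `ψ` maps the ends of `d` into the image of the
closed edge `e`. They are vertices, hence go to classes of ends of `e`, and to different ones by
injectivity. This fixes the orientation of `p'`. -/
theorem exists_corresponds (h₁ : T₁.IsTreeLike) (h₂ : T₂.IsTreeLike)
    (hW : W ⊆ T₂.contractionVerts F₁)
    (hφ : ∀ x, x ∈ T₁.verts ↔ (φ x : T₂.Contraction F₁) ∈ T₂.contractionVerts F₁)
    (p : T₁.OrientedEdge) :
    ∃ d e p', Corresponds T₁ T₂ (fun x => (φ x : T₂.Contraction F₁)) d e p p' := by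
  obtain ⟨d, hd⟩ : ∃ d, p.IsOn d := p.isEdge
  obtain ⟨e, he, himg⟩ := exists_image_inner_eq h₂ hW hφ d
  set ψ : X₁ → T₂.Contraction F₁ := fun x => φ x
  have hψc : Continuous ψ := continuous_subtype_val.comp φ.continuous
  have hψ : Function.Injective ψ := Subtype.val_injective.comp φ.injective
  have := T₂.t2Space_contraction F₁
  have hsub : ψ '' range (T₁.emb d) ⊆ T₂.toContraction F₁ '' range (T₂.emb e) := by
    refine (image_mono (T₁.range_emb_subset_closure_inner d)).trans
      ((image_closure_subset_closure_image hψc).trans (closure_minimal ?_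
        ((T₂.isCompact_range_emb e).image (T₂.continuous_toContraction F₁)).isClosed))
    rw [himg]
    exact image_mono (T₂.inner_subset_range e)
  have hend : ∀ x ∈ range (T₁.emb d), x ∈ T₁.verts → ψ x = T₂.toContraction F₁ (T₂.emb e 0) ∨
      ψ x = T₂.toContraction F₁ (T₂.emb e 1) := by
    intro x hx hxv
    obtain ⟨y, hy, hyx⟩ := hsub (mem_image_of_mem ψ hx)
    rcases T₂.range_emb_subset e hy with hy | rfl | rfl
    · exact absurd ((hφ x).1 hxv) (h₂.notMem_contractionVerts he ⟨y, hy, hyx⟩)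
    · exact Or.inl hyx.symm
    · exact Or.inr hyx.symm
  have hne : ψ p.tail ≠ ψ p.head := hψ.ne (hd.tail_ne_head h₁)
  rcases hend _ hd.tail_mem_range p.tail_mem with ht | ht <;>
    rcases hend _ hd.head_mem_range p.head_mem with hh | hh
  · exact absurd (ht.trans hh.symm) hne
  · exact ⟨d, e, ⟨T₂.emb e 0, T₂.emb e 1, e, Or.inl ⟨rfl, rfl⟩⟩,
      hd, Or.inl ⟨rfl, rfl⟩, he, himg, ht, hh⟩
  · exact ⟨d, e, ⟨T₂.emb e 1, T₂.emb e 0, e, Or.inr ⟨rfl, rfl⟩⟩,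
      hd, Or.inr ⟨rfl, rfl⟩, he, himg, ht, hh⟩
  · exact absurd (ht.trans hh.symm) hne

end Minor

end GraphLikeSpace

theorem mainTheorem4 {X₁ : Type*} {E₁ : Type*} {X₂ : Type*} {E₂ : Type*}
    [TopologicalSpace X₁] [TopologicalSpace X₂]
    (T₁ : GraphLikeSpace X₁ E₁) (T₂ : GraphLikeSpace X₂ E₂)
    (h₁ : T₁.IsTreeLike) (h₂ : T₂.IsTreeLike) (hminor : T₁.IsMinor T₂) :
    ∃ S : Set T₂.OrientedEdge, (∀ p ∈ S, p.inv ∈ S) ∧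
      ∃ φ : T₁.OrientedEdge ≃ S,
        (∀ p, (φ p.inv : T₂.OrientedEdge) = (φ p : T₂.OrientedEdge).inv) ∧
        (∀ p q, p ≤ q ↔ (φ p : T₂.OrientedEdge) ≤ (φ q : T₂.OrientedEdge)) := by
  obtain ⟨F₁, F₂, -, W, hW, -, φ, hφ⟩ := hminor
  have hψc : Continuous fun x => (φ x : T₂.Contraction F₁) :=
    continuous_subtype_val.comp φ.continuous
  have hψ : Function.Injective fun x => (φ x : T₂.Contraction F₁) :=
    Subtype.val_injective.comp φ.injective
  -- The choices are independent, but a corresponding oriented edge is unique in both directions, so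
  -- `Φ` is injective and commutes with the involution.
  choose d e Φ hΦ using GraphLikeSpace.exists_corresponds h₁ h₂ hW hφ
  have hinj : Function.Injective Φ := fun p q hpq =>
    (hΦ p).left_unique hψ (hpq ▸ hΦ q)
  have hinv : ∀ p, Φ p.inv = (Φ p).inv := fun p =>
    (hΦ p.inv).right_unique h₁ h₂ hψ (hΦ p).inv
  refine ⟨range Φ, ?_, Equiv.ofInjective Φ hinj, hinv, fun p q =>
    (hΦ p).le_iff h₁ h₂ hψ hψc (hΦ q)⟩
  rintro _ ⟨p, rfl⟩
  exact ⟨p.inv, hinv p⟩
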